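/- Let $M$ be a loopless matroid of rank $2$ on the ground set $[n]=\{1,\dots,n\}$, and let $Q(M)=\mathrm{conv}\{\sum_{i\in B}e_i : B \text{ a base of } M\}\subset\mathbb{R}^n$ be its matroid base polytope. Two elements of $M$ are called parallel if they are equal or form a two-element circuit; the equivalence classes of this relation are the parallelism classes of $M$. A hyperplane split of $Q(M)$ is a decomposition $Q(M)=Q(M_1)\cup Q(M_2)$ where $M_1,M_2$ are matroids on $[n]$ and $Q(M_1)\cap Q(M_2)$ is a proper face of both $Q(M_1)$ and $Q(M_2)$. A hyperplane $H$ gives a hyperplane split of $Q(M)$ if there is such a decomposition in which $Q(M_1)$ and $Q(M_2)$ are the intersections of $Q(M)$ with the two closed half-spaces bounded by $H$. Let $S\subseteq[n]$ and let $H$ be given by $\sum_{e\in S}x_e=1$. Then $H$ gives a hyperplane split of $Q(M)$ if and only if $S$ and $S^c=[n]\setminus S$ are each a union of at least two parallelism classes of $M$. (If $S=\emptyset$, the half-spaces are read as the solution sets of $\sum_{e\in S}x_e\le 1$ and $\sum_{e\in S}x_e\ge 1$, and both sides of the equivalence are false.) -/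

import Mathlib

namespace Matroid

/-- Two nonloops `e`, `f` of `M` are parallel if they are equal or form a two-element circuit. -/
def AreParallel {α : Type*} (M : Matroid α) (e f : α) : Prop :=
  M.IsNonloop e ∧ M.IsNonloop f ∧ (e = f ∨ M.IsCircuit {e, f})

/-- A parallelism class of `M`: the set of all elements parallel to a given nonloop. -/
def IsParallelClass {α : Type*} (M : Matroid α) (P : Set α) : Prop :=
  ∃ e, M.IsNonloop e ∧ P = {f | M.AreParallel e f}

/-- `T` is a union of at least two (distinct) parallelism classes of `M`. -/
def IsUnionOfTwoOrMoreParallelClasses {α : Type*} (M : Matroid α) (T : Set α) : Prop :=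
  ∃ C : Set (Set α), (∀ P ∈ C, M.IsParallelClass P) ∧ 2 ≤ C.encard ∧ T = ⋃₀ C

/-- The matroid base polytope: the convex hull of the indicator vectors of the bases. -/
noncomputable def basePolytope {n : ℕ} (M : Matroid (Fin n)) : Set (Fin n → ℝ) :=
  convexHull ℝ {x | ∃ B : Set (Fin n), M.IsBase B ∧ x = B.indicator 1}

end Matroid

/-- `F` is a proper face of the polytope `Q`: the locus in `Q` where some linear form attains its
maximum over `Q` (or the empty set), different from `Q`. -/
def IsProperFace {n : ℕ} (Q F : Set (Fin n → ℝ)) : Prop :=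
  IsExposed ℝ Q F ∧ F ≠ Q

namespace Matroid

/-- `Q(M) = Q(M₁) ∪ Q(M₂)` is a hyperplane split of `Q(M)`: `M₁` and `M₂` are matroids on the whole
index set, and `Q(M₁) ∩ Q(M₂)` is a proper face of both `Q(M₁)` and `Q(M₂)`. -/
structure IsHyperplaneSplit {n : ℕ} (M M₁ M₂ : Matroid (Fin n)) : Prop where
  ground_left : M₁.E = Set.univ
  ground_right : M₂.E = Set.univ
  union_eq : M.basePolytope = M₁.basePolytope ∪ M₂.basePolytope
  face_left : IsProperFace M₁.basePolytope (M₁.basePolytope ∩ M₂.basePolytope)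
  face_right : IsProperFace M₂.basePolytope (M₁.basePolytope ∩ M₂.basePolytope)

/-- The hyperplane `∑ e ∈ S, x e = k` gives a hyperplane split of `Q(M)`: there is a hyperplane
split whose two parts are the parts of `Q(M)` on the two closed sides of the hyperplane. -/
def GivesHyperplaneSplit {n : ℕ} (M : Matroid (Fin n)) (S : Finset (Fin n)) (k : ℝ) : Prop :=
  ∃ M₁ M₂ : Matroid (Fin n), M.IsHyperplaneSplit M₁ M₂ ∧
    M₁.basePolytope = M.basePolytope ∩ {x | ∑ e ∈ S, x e ≤ k} ∧
    M₂.basePolytope = M.basePolytope ∩ {x | k ≤ ∑ e ∈ S, x e}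

end Matroid

open Set
open scoped Pointwise

/-! Bases are pairs of nonparallel elements, so the condition on classes says: `S` and its
complement each contain a base, and every pair across is a base
(`isUnionOfTwoOrMoreParallelClasses_iff`). Necessity: properness of the faces gives a base on each
side, and a parallel pair across would break exchange in the half with `∑ e ∈ S, x e ≤ 1`.
Sufficiency: merging all of `S`, or all of its complement, into one class gives matroids
(`exists_isBase_iff_not_subset`) whose polytopes are exactly the two halves
(`basePolytope_inter_halfSpace`), because cutting at level `1` creates no new vertices. -/

/-- Splitting a convex hull along a level set of a linear form taking the values `2`, `1`, `0` on
the generators: the part where the form is at most `1` is generated by the low generators as soon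
as every midpoint of a high and a low generator is a combination of middle generators. -/
lemma mem_convexHull_union_of_le_one {E : Type*} [AddCommGroup E] [Module ℝ E] {A B C : Set E}
    (hA : A.Nonempty) (hB : B.Nonempty) (hC : C.Nonempty) (f : E →ₗ[ℝ] ℝ)
    (fA : ∀ x ∈ A, f x = 2) (fB : ∀ x ∈ B, f x = 1) (fC : ∀ x ∈ C, f x = 0)
    (hmid : ∀ a ∈ A, ∀ c ∈ C, (1 / 2 : ℝ) • (a + c) ∈ convexHull ℝ B) {x : E}
    (hx : x ∈ convexHull ℝ (A ∪ (B ∪ C))) (hfx : f x ≤ 1) : x ∈ convexHull ℝ (B ∪ C) := by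
  have level : ∀ (D : Set E) (r : ℝ), (∀ y ∈ D, f y = r) → ∀ y ∈ convexHull ℝ D, f y = r := by
    intro D r hD y hy
    exact convexHull_min (t := {z | f z = r}) hD (convex_hyperplane f.isLinear r) hy
  rw [convexHull_union hA (hB.mono subset_union_left), mem_convexJoin] at hx
  obtain ⟨a, ha, w, hw, p, q, hp, hq, hpq, rfl⟩ := hx
  rw [convexHull_union hB hC, mem_convexJoin] at hw
  obtain ⟨b, hb, c, hc, r, s, hr, hs, hrs, rfl⟩ := hw
  have hmem : (1 / 2 : ℝ) • (a + c) ∈ convexHull ℝ B := by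
    have hac : a + c ∈ convexHull ℝ (A + C) := by
      rw [convexHull_add]; exact Set.add_mem_add ha hc
    have hconv : Convex ℝ ((LinearMap.lsmul ℝ E (1 / 2 : ℝ)) ⁻¹' convexHull ℝ B) :=
      (convex_convexHull ℝ B).linear_preimage _
    refine convexHull_min ?_ hconv hac
    rintro _ ⟨a', ha', c', hc', rfl⟩
    exact hmid a' ha' c' hc'
  simp only [map_add, map_smul, smul_eq_mul, level A 2 fA a ha, level B 1 fB b hb,
    level C 0 fC c hc] at hfx
  -- The bound `2p + qr ≤ 1 = p + q` leaves enough weight `qs` on `c` to match all of `a`: `p • a +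
  -- (q * s) • c` becomes weight `2p` on the midpoint of `a` and `c`, plus `qs - p` on `c`.
  have hps : p ≤ q * s := by
    have : r = 1 - s := by linarith
    subst this
    nlinarith
  have hBsub := convexHull_mono (𝕜 := ℝ) (subset_union_left : B ⊆ B ∪ C)
  have hCsub := convexHull_mono (𝕜 := ℝ) (subset_union_right : C ⊆ B ∪ C)
  have key := (convex_convexHull ℝ (B ∪ C)).sum_mem (t := Finset.univ)
    (w := ![2 * p, q * r, q * s - p]) (z := ![(1 / 2 : ℝ) • (a + c), b, c])
    (by
      intro i _
      fin_cases i
      · simpa using hp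
      · simpa using mul_nonneg hq hr
      · simpa using hps)
    (by
      simp only [Fin.sum_univ_three, Matrix.cons_val_zero, Matrix.cons_val_one, Matrix.cons_val]
      have : q * (r + s) = q := by rw [hrs, mul_one]
      linarith)
    (by
      intro i _
      fin_cases i
      · exact hBsub hmem
      · exact hBsub hb
      · exact hCsub hc)
  convert key using 1
  simp only [Fin.sum_univ_three, Matrix.cons_val_zero, Matrix.cons_val_one, Matrix.cons_val]
  module

namespace Matroid

/-! ### Rank-two matroids as graphs of nonparallel pairs -/

section Pairs

variable {α : Type*} {M : Matroid α} {T : Set α} {a b c : α}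

lemma IsBase.encard_eq_two {B : Set α} (hrank : M.eRank = 2) (hB : M.IsBase B) :
    B.encard = 2 := by
  rw [hB.encard_eq_eRank, hrank]

lemma IsBase.ne_of_eRank_eq_two (hrank : M.eRank = 2) (h : M.IsBase {a, b}) : a ≠ b := by
  rintro rfl
  have := h.encard_eq_two hrank
  simp at this

/-- In a loopless matroid of rank two on the whole type, two elements are parallel exactly when
they do not form a base. -/
lemma areParallel_iff_not_isBase (hE : M.E = univ) [M.Loopless] (hrank : M.eRank = 2) :
    M.AreParallel a b ↔ ¬ M.IsBase {a, b} := by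
  have hnl : ∀ e, M.IsNonloop e := fun e ↦ M.isNonloop_of_loopless (by simp [hE])
  constructor
  · rintro ⟨-, -, rfl | hC⟩ hB
    · exact hB.ne_of_eRank_eq_two hrank rfl
    · exact hC.not_indep hB.indep
  · intro h
    refine ⟨hnl a, hnl b, ?_⟩
    by_cases hab : a = b
    · exact Or.inl hab
    right
    have hdep : ¬ M.Indep {a, b} := by
      intro hI
      obtain ⟨B, hB, hsub⟩ := hI.exists_isBase_superset
      have hBc := hB.encard_eq_two hrank
      have : ({a, b} : Set α) = B := by
        refine Set.Finite.eq_of_subset_of_encard_le (Set.toFinite _) hsub ?_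
        rw [hBc, Set.encard_pair hab]
      exact h (this ▸ hB)
    rw [isCircuit_iff_dep_forall_sdiff_singleton_indep]
    refine ⟨(not_indep_iff (by simp [hE])).1 hdep, ?_⟩
    rintro e (rfl | rfl)
    · refine M.subsingleton_indep ?_ (by simp [hE])
      intro x hx y hy
      simp at hx hy
      grind
    · refine M.subsingleton_indep ?_ (by simp [hE])
      intro x hx y hy
      simp at hx hy
      grind

/-- Augment `{c}` from `{a, b}`. The contrapositive is transitivity of parallelism. -/
lemma isBase_pair_or_isBase_pair (hE : M.E = univ) [M.Loopless] (hrank : M.eRank = 2)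
    (hab : M.IsBase {a, b}) (c : α) : M.IsBase {c, a} ∨ M.IsBase {c, b} := by
  have hc : M.Indep {c} := (M.isNonloop_of_loopless (by simp [hE])).indep
  obtain ⟨e, he, hI⟩ := hc.augment hab.indep (by
    rw [hab.encard_eq_two hrank, Set.encard_singleton]; norm_num)
  have hbase : M.IsBase {c, e} := by
    by_contra h
    rcases ((areParallel_iff_not_isBase hE hrank).2 h).2.2 with h | h
    · exact he.2 h.symm
    · exact h.not_indep (by rwa [Set.pair_comm])
  rcases he.1 with rfl | rfl
  exacts [Or.inl hbase, Or.inr hbase]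

lemma isUnionOfTwoOrMoreParallelClasses_iff (hE : M.E = univ) [M.Loopless]
    (hrank : M.eRank = 2) :
    M.IsUnionOfTwoOrMoreParallelClasses T ↔
      (∃ a ∈ T, ∃ b ∈ T, M.IsBase {a, b}) ∧ ∀ a ∈ T, ∀ b ∉ T, M.IsBase {a, b} := by
  have hnl : ∀ e, M.IsNonloop e := fun e ↦ M.isNonloop_of_loopless (by simp [hE])
  have hpar (a b : α) : M.AreParallel a b ↔ ¬ M.IsBase {a, b} :=
    areParallel_iff_not_isBase hE hrank
  have hrefl (a : α) : M.AreParallel a a := ⟨hnl a, hnl a, Or.inl rfl⟩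
  have htrans {a b c : α} (h₁ : M.AreParallel a b) (h₂ : M.AreParallel a c) :
      M.AreParallel b c := by
    rw [hpar] at *
    intro h
    exact (isBase_pair_or_isBase_pair hE hrank h a).elim h₁ h₂
  constructor
  · rintro ⟨C, hC, hcard, rfl⟩
    refine ⟨?_, ?_⟩
    · obtain ⟨P, Q, hP, hQ, hPQ⟩ := Set.one_lt_encard_iff.1
        (lt_of_lt_of_le (by norm_num : (1 : ℕ∞) < 2) hcard)
      obtain ⟨p, -, rfl⟩ := hC P hP
      obtain ⟨q, -, rfl⟩ := hC Q hQ
      refine ⟨p, ⟨_, hP, hrefl p⟩, q, ⟨_, hQ, hrefl q⟩, ?_⟩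
      by_contra h
      rw [← hpar] at h
      refine hPQ (Set.ext fun x ↦ ⟨fun hx ↦ htrans h hx, fun hx ↦ ?_⟩)
      exact htrans (htrans h (hrefl p)) hx
    · rintro a ⟨P, hP, haP⟩ b hb
      by_contra h
      rw [← hpar] at h
      obtain ⟨p, -, rfl⟩ := hC P hP
      exact hb ⟨_, hP, htrans (htrans haP (hrefl p)) h⟩
  · rintro ⟨⟨a, ha, b, hb, hab⟩, hcross⟩
    have hsub : ∀ e ∈ T, {f | M.AreParallel e f} ⊆ T := by
      intro e he f hf
      by_contra hfT
      exact (hpar e f).1 hf (hcross e he f hfT)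
    refine ⟨{P | M.IsParallelClass P ∧ P ⊆ T}, fun P hP ↦ hP.1, ?_, ?_⟩
    · have h1 : (1 : ℕ∞) < {P | M.IsParallelClass P ∧ P ⊆ T}.encard := by
        refine Set.one_lt_encard_iff.2 ⟨_, _, ⟨⟨a, hnl a, rfl⟩, hsub a ha⟩,
          ⟨⟨b, hnl b, rfl⟩, hsub b hb⟩, fun h ↦ ?_⟩
        have : M.AreParallel a b := by
          change b ∈ {f | M.AreParallel a f}
          rw [h]; exact hrefl b
        exact (hpar a b).1 this hab
      simpa [one_add_one_eq_two] using Order.add_one_le_of_lt h1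
    · refine Set.Subset.antisymm (fun e he ↦ ⟨_, ⟨⟨e, hnl e, rfl⟩, hsub e he⟩, hrefl e⟩) ?_
      exact Set.sUnion_subset fun P hP ↦ hP.2

end Pairs

/-- The matroid obtained from the rank-two matroid `M` by making all elements of `T` parallel: its
bases are the bases of `M` that are not contained in `T`. -/
lemma exists_isBase_iff_not_subset {α : Type*} [Finite α] {M : Matroid α} (hrank : M.eRank = 2)
    {T : Set α} (hne : ∃ B, M.IsBase B ∧ ¬ B ⊆ T) (hcross : ∀ a ∈ T, ∀ b ∉ T, M.IsBase {a, b}) :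
    ∃ N : Matroid α, N.E = univ ∧ ∀ B, N.IsBase B ↔ M.IsBase B ∧ ¬ B ⊆ T := by
  refine ⟨Matroid.ofIsBaseOfFinite (E := univ) Set.finite_univ
    (fun B ↦ M.IsBase B ∧ ¬ B ⊆ T) hne ?_ (fun _ _ ↦ Set.subset_univ _), rfl, fun B ↦ Iff.rfl⟩
  rintro B B' ⟨hB, hBT⟩ ⟨hB', hBT'⟩ e he
  -- If what remains of `B` is a single element of `T`, any element of `B'` outside `T` completes it
  -- across; otherwise ordinary exchange keeps an element outside `T`.
  by_cases hsub : B \ {e} ⊆ T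
  · obtain ⟨f, hfB', hfT⟩ := Set.not_subset.1 hBT'
    have hcard : (B \ {e}).encard = 1 := by
      have := Set.encard_sdiff_singleton_add_one he.1
      rw [hB.encard_eq_two hrank, ← one_add_one_eq_two] at this
      exact WithTop.add_right_cancel ENat.one_ne_top this
    obtain ⟨y, hy⟩ := Set.encard_eq_one.1 hcard
    have hyT : y ∈ T := hsub (hy ▸ rfl)
    refine ⟨f, ⟨hfB', fun hfB ↦ hfT (hsub ⟨hfB, ?_⟩)⟩, ?_, fun h ↦ hfT (h (mem_insert _ _))⟩
    · rintro rfl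
      exact he.2 hfB'
    · rw [hy, Set.pair_comm]
      exact hcross y hyT f hfT
  · obtain ⟨f, hf, hbase⟩ := hB.exchange hB' he
    exact ⟨f, hf, hbase, fun h ↦ hsub ((Set.subset_insert _ _).trans h)⟩

/-! ### Base polytopes and their slices -/

section Polytope

variable {n : ℕ} {M : Matroid (Fin n)}

/-- The form with weight `1` on `B` and `-1` off `B` is maximal among 0/1 vectors only at the
indicator of `B`. Hence a polytope determines its matroid's bases. -/
lemma indicator_mem_basePolytope_iff {B : Set (Fin n)} :
    B.indicator 1 ∈ M.basePolytope ↔ M.IsBase B := by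
  classical
  refine ⟨fun h ↦ ?_, fun h ↦ subset_convexHull ℝ _ ⟨B, h, rfl⟩⟩
  by_contra hB
  let f : (Fin n → ℝ) →ₗ[ℝ] ℝ := ∑ i, (if i ∈ B then (1 : ℝ) else -1) • LinearMap.proj i
  have hf (x : Fin n → ℝ) : f x = ∑ i, (if i ∈ B then (1 : ℝ) else -1) * x i := by
    simp only [f, LinearMap.sum_apply, LinearMap.smul_apply, LinearMap.proj_apply, smul_eq_mul]
  have hlt : M.basePolytope ⊆ {x | f x < f (B.indicator 1)} := by
    refine convexHull_min ?_ (convex_halfSpace_lt f.isLinear _)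
    rintro _ ⟨B', hB', rfl⟩
    change f _ < f _
    rw [hf, hf]
    have hne : ¬ ∀ i, i ∈ B' ↔ i ∈ B := fun h ↦ hB ((Set.ext h : B' = B) ▸ hB')
    push Not at hne
    obtain ⟨j, hj⟩ := hne
    refine Finset.sum_lt_sum (fun i _ ↦ ?_) ⟨j, Finset.mem_univ j, ?_⟩
    · by_cases h1 : i ∈ B <;> by_cases h2 : i ∈ B' <;> simp [h1, h2]
    · rcases hj with ⟨h2, h1⟩ | ⟨h2, h1⟩ <;> simp [h1, h2]
  exact lt_irrefl (f (B.indicator 1)) (hlt h)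

lemma sum_indicator_pair {a b : Fin n} (hab : a ≠ b) (S : Finset (Fin n)) :
    ∑ e ∈ S, ({a, b} : Set (Fin n)).indicator (1 : Fin n → ℝ) e =
      (if a ∈ S then 1 else 0) + (if b ∈ S then 1 else 0) := by
  have h (e : Fin n) : ({a, b} : Set (Fin n)).indicator (1 : Fin n → ℝ) e =
      (if a = e then 1 else 0) + (if b = e then 1 else 0) := by
    by_cases h1 : a = e <;> by_cases h2 : b = e <;> simp [Set.indicator, h1, h2] <;> grind
  simp [h, Finset.sum_add_distrib]

lemma IsBase.exists_eq_pair (hrank : M.eRank = 2) {B : Set (Fin n)} (hB : M.IsBase B) :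
    ∃ a b, a ≠ b ∧ B = {a, b} :=
  Set.encard_eq_two.1 (hB.encard_eq_two hrank)

/-- The linear form `x ↦ ∑ e ∈ S, x e`. -/
def sumForm (S : Finset (Fin n)) : (Fin n → ℝ) →L[ℝ] ℝ := ∑ e ∈ S, ContinuousLinearMap.proj e

lemma sumForm_apply (S : Finset (Fin n)) (x : Fin n → ℝ) : sumForm S x = ∑ e ∈ S, x e := by
  simp [sumForm]

lemma sum_add_sum_compl_of_mem_basePolytope (hrank : M.eRank = 2) (S : Finset (Fin n))
    {x : Fin n → ℝ} (hx : x ∈ M.basePolytope) : ∑ e ∈ S, x e + ∑ e ∈ Sᶜ, x e = 2 := by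
  rw [Finset.sum_add_sum_compl, ← sumForm_apply]
  refine convexHull_min (t := {z | sumForm Finset.univ z = 2}) ?_
    (convex_hyperplane (sumForm Finset.univ).toLinearMap.isLinear 2) hx
  rintro _ ⟨B, hB, rfl⟩
  obtain ⟨a, b, hab, rfl⟩ := hB.exists_eq_pair hrank
  rw [Set.mem_ofPred_eq, sumForm_apply, sum_indicator_pair hab]
  norm_num

/-- If all pairs across `T` and its complement are bases, then the part of the base polytope where
the coordinates in `T` sum to at most `1` is the base polytope of the matroid in which `T` has been
made parallel. -/
lemma basePolytope_inter_halfSpace (hrank : M.eRank = 2) {T : Finset (Fin n)}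
    (hin : ∃ a ∈ T, ∃ b ∈ T, M.IsBase {a, b}) (hout : ∃ a ∉ T, ∃ b ∉ T, M.IsBase {a, b})
    (hcross : ∀ a ∈ T, ∀ b ∉ T, M.IsBase {a, b}) {N : Matroid (Fin n)}
    (hN : ∀ B, N.IsBase B ↔ M.IsBase B ∧ ¬ B ⊆ (T : Set (Fin n))) :
    N.basePolytope = M.basePolytope ∩ {x | ∑ e ∈ T, x e ≤ 1} := by
  refine Set.Subset.antisymm (Set.subset_inter ?_ ?_) ?_
  · refine convexHull_mono ?_
    rintro _ ⟨B, hB, rfl⟩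
    exact ⟨B, ((hN B).1 hB).1, rfl⟩
  · simp_rw [← sumForm_apply]
    refine convexHull_min ?_ (convex_halfSpace_le (sumForm T).toLinearMap.isLinear 1)
    rintro _ ⟨B, hB, rfl⟩
    obtain ⟨hB, hBT⟩ := (hN B).1 hB
    obtain ⟨a, b, hab, rfl⟩ := hB.exists_eq_pair hrank
    rw [Set.mem_ofPred_eq, sumForm_apply, sum_indicator_pair hab]
    by_cases ha : a ∈ T <;> by_cases hb : b ∈ T <;> simp [ha, hb]
    exact (hBT (by simp [Set.insert_subset_iff, ha, hb])).elim
  · rintro x ⟨hx, hxT⟩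
    let pairs (U V : Finset (Fin n)) : Set (Fin n → ℝ) :=
      {x | ∃ a ∈ U, ∃ b ∈ V, M.IsBase {a, b} ∧ x = ({a, b} : Set (Fin n)).indicator 1}
    obtain ⟨a₀, ha₀, a₁, ha₁, ha⟩ := hin
    obtain ⟨c₀, hc₀, c₁, hc₁, hc⟩ := hout
    have hval (U V : Finset (Fin n)) (x) (hx : x ∈ pairs U V) : ∃ a ∈ U, ∃ b ∈ V,
        sumForm T x = (if a ∈ T then 1 else 0) + (if b ∈ T then 1 else 0) := by
      obtain ⟨a, ha, b, hb, hab, rfl⟩ := hx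
      exact ⟨a, ha, b, hb, by
        rw [sumForm_apply, sum_indicator_pair (hab.ne_of_eRank_eq_two hrank)]⟩
    have hmem : x ∈ convexHull ℝ (pairs T Tᶜ ∪ pairs Tᶜ Tᶜ) := by
      refine mem_convexHull_union_of_le_one (A := pairs T T) (B := pairs T Tᶜ) (C := pairs Tᶜ Tᶜ)
        ⟨_, ⟨a₀, ha₀, a₁, ha₁, ha, rfl⟩⟩
        ⟨_, ⟨a₀, ha₀, c₀, Finset.mem_compl.2 hc₀, hcross a₀ ha₀ c₀ hc₀, rfl⟩⟩
        ⟨_, ⟨c₀, Finset.mem_compl.2 hc₀, c₁, Finset.mem_compl.2 hc₁, hc, rfl⟩⟩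
        (sumForm T).toLinearMap ?_ ?_ ?_ ?_ ?_ ?_
      · intro x hx
        obtain ⟨a, ha, b, hb, h⟩ := hval _ _ x hx
        simp [h, ha, hb]; norm_num
      · intro x hx
        obtain ⟨a, ha, b, hb, h⟩ := hval _ _ x hx
        simp at hb
        simp [h, ha, hb]
      · intro x hx
        obtain ⟨a, ha, b, hb, h⟩ := hval _ _ x hx
        simp at ha hb
        simp [h, ha, hb]
      · rintro _ ⟨a, ha, b, hb, hab, rfl⟩ _ ⟨c, hc, d, hd, hcd, rfl⟩
        have hc' : c ∉ T := by simpa using hc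
        have hd' : d ∉ T := by simpa using hd
        have hab' := hab.ne_of_eRank_eq_two hrank
        have hcd' := hcd.ne_of_eRank_eq_two hrank
        -- Regroup `(e_a + e_b) + (e_c + e_d)` as `(e_a + e_c) + (e_b + e_d)`: both new pairs go
        -- across.
        have h1 : ({a, c} : Set (Fin n)).indicator 1 ∈ convexHull ℝ (pairs T Tᶜ) :=
          subset_convexHull ℝ _ ⟨a, ha, c, hc, hcross a ha c hc', rfl⟩
        have h2 : ({b, d} : Set (Fin n)).indicator 1 ∈ convexHull ℝ (pairs T Tᶜ) :=
          subset_convexHull ℝ _ ⟨b, hb, d, hd, hcross b hb d hd', rfl⟩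
        have h3 := convex_convexHull ℝ (pairs T Tᶜ) h1 h2 (a := 1 / 2) (b := 1 / 2)
          (by norm_num) (by norm_num) (by norm_num)
        rw [← smul_add] at h3
        convert h3 using 2
        have hac : a ≠ c := fun h ↦ hc' (h ▸ ha)
        have hbd : b ≠ d := fun h ↦ hd' (h ▸ hb)
        have hpair {u v : Fin n} (huv : u ≠ v) :
            ({u, v} : Set (Fin n)).indicator (1 : Fin n → ℝ) =
              ({u} : Set (Fin n)).indicator 1 + ({v} : Set (Fin n)).indicator 1 := by
          rw [Set.insert_eq, Set.indicator_union_of_disjoint (by simpa using huv)]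
          rfl
        rw [hpair hab', hpair hcd', hpair hac, hpair hbd]
        abel
      · refine convexHull_mono ?_ hx
        rintro _ ⟨B, hB, rfl⟩
        obtain ⟨a, b, hab, rfl⟩ := hB.exists_eq_pair hrank
        by_cases ha : a ∈ T <;> by_cases hb : b ∈ T
        · exact Or.inl ⟨a, ha, b, hb, hB, rfl⟩
        · exact Or.inr (Or.inl ⟨a, ha, b, by simpa using hb, hB, rfl⟩)
        · exact Or.inr (Or.inl ⟨b, hb, a, by simpa using ha, by rwa [Set.pair_comm],
            by rw [Set.pair_comm]⟩)
        · exact Or.inr (Or.inr ⟨a, by simpa using ha, b, by simpa using hb, hB, rfl⟩)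
      · simpa [sumForm_apply] using hxT
    refine convexHull_mono ?_ hmem
    rintro _ (⟨a, -, b, hb, hab, rfl⟩ | ⟨a, -, b, hb, hab, rfl⟩) <;>
    · refine ⟨_, (hN _).2 ⟨hab, fun h ↦ ?_⟩, rfl⟩
      have : b ∈ T := by simpa using h (Set.mem_insert_of_mem a rfl)
      simp [this] at hb

/-- If the slice is nonempty, `k` is the maximum of `f` on `Q`; an empty slice is exposed by
convention. -/
lemma isProperFace_inter_hyperplane {Q : Set (Fin n → ℝ)} (f : (Fin n → ℝ) →L[ℝ] ℝ) {k : ℝ}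
    (hle : ∀ x ∈ Q, f x ≤ k) (hlt : ∃ x ∈ Q, f x < k) : IsProperFace Q {x ∈ Q | f x = k} := by
  refine ⟨fun ⟨z, hz, hzk⟩ ↦ ⟨f, ?_⟩, fun h ↦ ?_⟩
  · ext x
    refine ⟨fun ⟨hx, hxk⟩ ↦ ⟨hx, fun y hy ↦ hxk ▸ hle y hy⟩, fun ⟨hx, hmax⟩ ↦ ⟨hx, ?_⟩⟩
    exact le_antisymm (hle x hx) (hzk ▸ hmax z hz)
  · obtain ⟨x, hx, hxk⟩ := hlt
    rw [← h] at hx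
    exact hxk.ne hx.2

/-- A point of the base polytope strictly on one side of `∑ e ∈ S, x e = 1` forces a base
avoiding the other side. -/
lemma exists_isBase_pair_notMem (hrank : M.eRank = 2) {S : Finset (Fin n)} {x : Fin n → ℝ}
    (hx : x ∈ M.basePolytope) (hlt : ∑ e ∈ S, x e < 1) :
    ∃ a ∉ S, ∃ b ∉ S, M.IsBase {a, b} := by
  by_contra! h
  have : M.basePolytope ⊆ {x | 1 ≤ sumForm S x} := by
    refine convexHull_min ?_ (convex_halfSpace_ge (sumForm S).toLinearMap.isLinear 1)
    rintro _ ⟨B, hB, rfl⟩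
    obtain ⟨a, b, hab, rfl⟩ := hB.exists_eq_pair hrank
    rw [Set.mem_ofPred_eq, sumForm_apply, sum_indicator_pair hab]
    by_cases ha : a ∈ S <;> by_cases hb : b ∈ S <;> simp [ha, hb]
    exact (h a ha b hb hB).elim
  have h1 := this hx
  rw [Set.mem_ofPred_eq, sumForm_apply] at h1
  linarith

/-! ### Necessity -/

lemma GivesHyperplaneSplit.exists_isBase_and_isBase_of_mem_of_notMem (hE : M.E = univ)
    [M.Loopless] (hrank : M.eRank = 2) {S : Finset (Fin n)} (h : M.GivesHyperplaneSplit S 1) :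
    (∃ a ∈ S, ∃ b ∈ S, M.IsBase {a, b}) ∧ (∃ a ∉ S, ∃ b ∉ S, M.IsBase {a, b}) ∧
      ∀ a ∈ S, ∀ b ∉ S, M.IsBase {a, b} := by
  obtain ⟨M₁, M₂, hsplit, h₁, h₂⟩ := h
  have hout : ∃ a ∉ S, ∃ b ∉ S, M.IsBase {a, b} := by
    by_contra hcon
    -- With no base avoiding `S`, all of `Q(M)` lies in the upper half-space, so the common face is
    -- all of `Q(M₁)`.
    refine hsplit.face_left.2 (Set.inter_eq_left.2 fun x hx ↦ ?_)
    rw [h₁] at hx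
    rw [h₂]
    refine ⟨hx.1, ?_⟩
    rw [Set.mem_ofPred_eq, ← not_lt]
    exact fun hlt ↦ hcon (exists_isBase_pair_notMem hrank hx.1 hlt)
  have hin : ∃ a ∈ S, ∃ b ∈ S, M.IsBase {a, b} := by
    by_contra hcon
    refine hsplit.face_right.2 (Set.inter_eq_right.2 fun x hx ↦ ?_)
    rw [h₂] at hx
    rw [h₁]
    refine ⟨hx.1, ?_⟩
    rw [Set.mem_ofPred_eq, ← not_lt]
    refine fun hlt ↦ hcon ?_
    have := sum_add_sum_compl_of_mem_basePolytope hrank S hx.1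
    simpa using exists_isBase_pair_notMem hrank (S := Sᶜ) hx.1 (by linarith)
  refine ⟨hin, hout, fun a ha b hb ↦ ?_⟩
  by_contra hab
  -- `M₁` is known only through its polytope; reading off vertices, its base pairs are those of `M`
  -- not inside `S`.
  have hbase {u v : Fin n} (huv : M.IsBase {u, v}) (hv : ¬ (u ∈ S ∧ v ∈ S)) :
      M₁.IsBase {u, v} := by
    rw [← indicator_mem_basePolytope_iff, h₁]
    refine ⟨indicator_mem_basePolytope_iff.2 huv, ?_⟩
    rw [Set.mem_ofPred_eq, sum_indicator_pair (huv.ne_of_eRank_eq_two hrank)]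
    by_cases hu : u ∈ S <;> by_cases hv : v ∈ S <;> simp_all
  have hbase' {u v : Fin n} (huv : M₁.IsBase {u, v}) :
      M.IsBase {u, v} ∧ ¬ (u ∈ S ∧ v ∈ S) := by
    rw [← indicator_mem_basePolytope_iff, h₁] at huv
    have hM := indicator_mem_basePolytope_iff.1 huv.1
    refine ⟨hM, fun ⟨hu, hv⟩ ↦ ?_⟩
    have := huv.2
    rw [Set.mem_ofPred_eq, sum_indicator_pair (hM.ne_of_eRank_eq_two hrank)] at this
    simp [hu, hv] at this
    norm_num at this
  have hmeet (z : Fin n) {U : Set (Fin n)} (hU : ∃ u ∈ U, ∃ v ∈ U, M.IsBase {u, v}) :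
      ∃ c ∈ U, M.IsBase {z, c} := by
    obtain ⟨u, hu, v, hv, huv⟩ := hU
    rcases isBase_pair_or_isBase_pair hE hrank huv z with h | h
    exacts [⟨u, hu, h⟩, ⟨v, hv, h⟩]
  -- `a` and `b` are parallel, so exchange fails between `{a, e}` and `{b, c}`
  have hpar {z : Fin n} (h : M.IsBase {a, z}) : M.IsBase {b, z} := by
    rcases isBase_pair_or_isBase_pair hE hrank h b with h | h
    · exact absurd (by rwa [Set.pair_comm]) hab
    · exact h
  have hpar' {z : Fin n} (h : M.IsBase {b, z}) : M.IsBase {a, z} := by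
    rcases isBase_pair_or_isBase_pair hE hrank h a with h | h
    · exact absurd h hab
    · exact h
  obtain ⟨c, hc, hac⟩ := hmeet a (U := S) (by simpa using hin)
  obtain ⟨e, he, hbe⟩ := hmeet b (U := (S : Set (Fin n))ᶜ) (by simpa using hout)
  replace he : e ∉ S := by simpa using he
  replace hc : c ∈ S := by simpa using hc
  have hae := hpar' hbe
  have hbc := hpar hac
  have hne := hae.ne_of_eRank_eq_two hrank
  have hbe' := hbe.ne_of_eRank_eq_two hrank
  -- Replacing `e` would yield `{a, b}`, not a base of `M`, or `{a, c}`, which lies inside `S`.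
  obtain ⟨y, hy, hbad⟩ := (hbase hae (by simp [he])).exchange (hbase hbc (by simp [hb]))
    (e := e) ⟨by simp, by
      rintro (h | h)
      · exact hbe' h.symm
      · exact he (h ▸ hc)⟩
  have hdiff : ({a, e} : Set (Fin n)) \ {e} = {a} := by
    ext z; simp; grind
  rw [hdiff, Set.pair_comm] at hbad
  rcases hy.1 with rfl | rfl
  · exact hab (hbase' hbad).1
  · exact (hbase' hbad).2 ⟨ha, hc⟩

/-! ### Sufficiency -/

lemma givesHyperplaneSplit_of_isBase (hrank : M.eRank = 2) {S : Finset (Fin n)}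
    (hin : ∃ a ∈ S, ∃ b ∈ S, M.IsBase {a, b}) (hout : ∃ a ∉ S, ∃ b ∉ S, M.IsBase {a, b})
    (hcross : ∀ a ∈ S, ∀ b ∉ S, M.IsBase {a, b}) : M.GivesHyperplaneSplit S 1 := by
  have hcross' : ∀ a ∈ Sᶜ, ∀ b ∉ Sᶜ, M.IsBase {a, b} := by
    intro a ha b hb
    rw [Set.pair_comm]
    exact hcross b (by simpa using hb) a (by simpa using ha)
  have hexists {T : Finset (Fin n)} (h : ∃ a ∉ T, ∃ b ∉ T, M.IsBase {a, b}) :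
      ∃ B, M.IsBase B ∧ ¬ B ⊆ (T : Set (Fin n)) := by
    obtain ⟨a, ha, b, -, hab⟩ := h
    exact ⟨_, hab, fun h ↦ ha (by simpa using h (Set.mem_insert a _))⟩
  have hout' : ∃ a ∉ Sᶜ, ∃ b ∉ Sᶜ, M.IsBase {a, b} := by simpa using hin
  obtain ⟨M₁, hE₁, hM₁⟩ := exists_isBase_iff_not_subset hrank (T := (S : Set (Fin n)))
    (hexists hout) (by simpa using hcross)
  obtain ⟨M₂, hE₂, hM₂⟩ := exists_isBase_iff_not_subset hrank
    (T := ((Sᶜ : Finset (Fin n)) : Set (Fin n))) (hexists hout')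
    (fun a ha b hb ↦ hcross' a (by simpa using ha) b (by simpa using hb))
  have h₁ := basePolytope_inter_halfSpace hrank hin hout hcross hM₁
  -- Coordinates sum to `2` on `Q(M)`, so at most `1` on `Sᶜ` means at least `1` on `S`.
  have h₂ : M₂.basePolytope = M.basePolytope ∩ {x | 1 ≤ ∑ e ∈ S, x e} := by
    rw [basePolytope_inter_halfSpace hrank (by simpa using hout) hout' hcross' hM₂]
    ext x
    refine and_congr_right fun hx ↦ ?_
    have := sum_add_sum_compl_of_mem_basePolytope hrank S hx
    simp only [Set.mem_ofPred_eq]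
    constructor <;> intro h <;> linarith
  refine ⟨M₁, M₂, ⟨hE₁, hE₂, ?_, ?_, ?_⟩, h₁, h₂⟩
  · rw [h₁, h₂, ← Set.inter_union_distrib_left, eq_comm, Set.inter_eq_left]
    exact fun x _ ↦ le_total (∑ e ∈ S, x e) 1
  · have hface : M₁.basePolytope ∩ M₂.basePolytope =
        {x ∈ M₁.basePolytope | sumForm S x = 1} := by
      ext x
      simp only [h₁, h₂, Set.mem_inter_iff, Set.mem_ofPred_eq, sumForm_apply]
      grind
    rw [hface]
    refine isProperFace_inter_hyperplane _ (fun x hx ↦ ?_) ?_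
    · rw [h₁] at hx
      simpa [sumForm_apply] using hx.2
    · obtain ⟨a, ha, b, hb, hab⟩ := hout
      have hval := sum_indicator_pair (hab.ne_of_eRank_eq_two hrank) S
      simp only [ha, hb, if_false, add_zero] at hval
      refine ⟨({a, b} : Set (Fin n)).indicator 1, ?_, by rw [sumForm_apply, hval]; norm_num⟩
      rw [h₁]
      exact ⟨indicator_mem_basePolytope_iff.2 hab, by rw [Set.mem_ofPred_eq, hval]; norm_num⟩
  · have hface : M₁.basePolytope ∩ M₂.basePolytope =
        {x ∈ M₂.basePolytope | (-sumForm S) x = -1} := by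
      ext x
      simp only [h₁, h₂, Set.mem_inter_iff, Set.mem_ofPred_eq, _root_.neg_apply,
        sumForm_apply]
      grind
    rw [hface]
    refine isProperFace_inter_hyperplane _ (fun x hx ↦ ?_) ?_
    · rw [h₂] at hx
      simpa [sumForm_apply] using hx.2
    · obtain ⟨a, ha, b, hb, hab⟩ := hin
      have hval := sum_indicator_pair (hab.ne_of_eRank_eq_two hrank) S
      simp only [ha, hb, if_true] at hval
      refine ⟨({a, b} : Set (Fin n)).indicator 1, ?_, by
        rw [_root_.neg_apply, sumForm_apply, hval]; norm_num⟩
      rw [h₂]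
      exact ⟨indicator_mem_basePolytope_iff.2 hab, by rw [Set.mem_ofPred_eq, hval]; norm_num⟩

end Polytope

end Matroid

theorem mainTheorem8 (n : ℕ) (M : Matroid (Fin n)) (hE : M.E = Set.univ)
    (hloopless : M.Loopless) (hrank : M.eRank = 2) (S : Finset (Fin n)) :
    M.GivesHyperplaneSplit S 1 ↔
      M.IsUnionOfTwoOrMoreParallelClasses (S : Set (Fin n)) ∧
        M.IsUnionOfTwoOrMoreParallelClasses ((S : Set (Fin n))ᶜ) := by
  rw [Matroid.isUnionOfTwoOrMoreParallelClasses_iff hE hrank,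
    Matroid.isUnionOfTwoOrMoreParallelClasses_iff hE hrank]
  constructor
  · intro h
    obtain ⟨hin, hout, hcross⟩ :=
      h.exists_isBase_and_isBase_of_mem_of_notMem hE hrank
    refine ⟨⟨by simpa using hin, by simpa using hcross⟩, by simpa using hout, ?_⟩
    intro a ha b hb
    rw [Set.pair_comm]
    exact hcross b (by simpa using hb) a (by simpa using ha)
  · rintro ⟨⟨hin, hcross⟩, hout, -⟩
    exact Matroid.givesHyperplaneSplit_of_isBase hrank (by simpa using hin)
      (by simpa using hout) (by simpa using hcross)
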